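/- Let $\Omega\subset\mathbb{C}$ be a nonempty, bounded, connected open set that is regular (i.e. $\Omega$ equals the interior of its closure $\overline{\Omega}$) and such that $\mathbb{C}\setminus\overline{\Omega}$ is connected. Then there exists an entire function $f:\mathbb{C}\to\mathbb{C}$ such that $\Omega$ is an escaping wandering domain of $f$ and, for every $n\ge 0$, the iterate $f^n|_\Omega$ is univalent (holomorphic and injective). Here the Fatou set of $f$ is the set of points having an open neighbourhood on which the iterates $(f^n)_{n\ge 0}$ form a normal family, meaning that every sequence of iterates has a subsequence converging locally uniformly with respect to the spherical metric to a map into $\mathbb{C}\cup\{\infty\}$. A Fatou component is a connected component of the Fatou set. A wandering domain is a Fatou component $\Omega$ with $f^n(\Omega)\cap f^m(\Omega)=\emptyset$ for all integers $n,m\ge 0$ with $n\ne m$. It is escaping if the constant $\infty$ is the one and only limit function of $(f^n)$ on $\Omega$, where the limit functions are the locally uniform limits (in the spherical metric) of subsequences $(f^{n_k}|_\Omega)$ with $n_1<n_2<\cdots$. -/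

import Mathlib

open Set Filter Topology

noncomputable section

namespace EntireDynamics

/-- The restriction of the iterate `f^n` to `U`, regarded as a continuous map into the Riemann
sphere `OnePoint ℂ`. The space `C(U, OnePoint ℂ)` carries the compact-open topology, in which
convergence is locally uniform convergence on `U` (for `U` open) with respect to the spherical
metric. -/
def iterateOn (f : C(ℂ, ℂ)) (U : Set ℂ) (n : ℕ) : C(U, OnePoint ℂ) where
  toFun z := ((f^[n] (z : ℂ) : ℂ) : OnePoint ℂ)
  continuous_toFun :=
    OnePoint.continuous_coe.comp ((f.continuous.iterate n).comp continuous_subtype_val)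

/-- A family of maps from `U` to the sphere is normal if every sequence of its members has a
subsequence that converges locally uniformly on `U`. The limit may take the value `∞`. -/
def IsNormalFamily {U : Set ℂ} (𝒢 : Set C(U, OnePoint ℂ)) : Prop :=
  ∀ u : ℕ → C(U, OnePoint ℂ), (∀ k, u k ∈ 𝒢) →
    ∃ φ : ℕ → ℕ, StrictMono φ ∧ ∃ g : C(U, OnePoint ℂ), Tendsto (u ∘ φ) atTop (𝓝 g)

/-- The Fatou set: the points with an open neighbourhood on which the iterates form a
normal family. -/
def fatouSet (f : C(ℂ, ℂ)) : Set ℂ :=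
  {p | ∃ U : Set ℂ, IsOpen U ∧ p ∈ U ∧ IsNormalFamily (range (iterateOn f U))}

/-- The Fatou components are the connected components of the Fatou set. -/
def IsFatouComponent (f : C(ℂ, ℂ)) (Ω : Set ℂ) : Prop :=
  ∃ p ∈ fatouSet f, Ω = connectedComponentIn (fatouSet f) p

/-- A wandering domain is a Fatou component that is not pre-periodic. -/
def IsWanderingDomain (f : C(ℂ, ℂ)) (Ω : Set ℂ) : Prop :=
  IsFatouComponent f Ω ∧
    ¬ ∃ n m : ℕ, n ≠ m ∧ ((f^[n] '' Ω) ∩ (f^[m] '' Ω)).Nonempty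

/-- The limit functions of `(f^n)` on `Ω`: the locally uniform limits of subsequences. -/
def limitFunctions (f : C(ℂ, ℂ)) (Ω : Set ℂ) : Set C(Ω, OnePoint ℂ) :=
  {g | ∃ φ : ℕ → ℕ, StrictMono φ ∧ Tendsto (fun k => iterateOn f Ω (φ k)) atTop (𝓝 g)}

/-- A wandering domain is escaping if the constant `∞` is its only limit function. -/
def IsEscapingWanderingDomain (f : C(ℂ, ℂ)) (Ω : Set ℂ) : Prop :=
  IsWanderingDomain f Ω ∧ limitFunctions f Ω = {ContinuousMap.const Ω OnePoint.infty}

/-- Univalent maps are the injective holomorphic ones. -/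
def IsUnivalentOn (g : ℂ → ℂ) (Ω : Set ℂ) : Prop :=
  DifferentiableOn ℂ g Ω ∧ InjOn g Ω

end EntireDynamics

end

/-! Let K be the closure of Ω. The map f is a limit of entire functions built inductively so that
the orbit of K visits disjoint discs marching off to ∞, while points p_k outside K, accumulating at
every point of ∂K, are sent by f^(k+1) into the unit disc. The iterates tend to ∞ uniformly on Ω, so
Ω lies in the Fatou set. At a boundary point a limit function would be ∞ by continuity from Ω and
finite along the p_k, so Ω is a whole Fatou component (`notMem_fatouSet`); disjointness of the discs
makes it wandering.

In the inductive step the new map must follow an affine map T near f^k(K) but send f^k(p_k) close to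
0. As the complement of K is connected, some entire g has g(p_k) = 1 and |g| < 1 on K
(`exists_entire_peak`). With H an approximate left inverse of f^k, the product T·(1 - (g ∘ H)^n)
does both (`exists_entire_separating`); `exists_entire_approx_two_discs` glues it to the previous
map. Approximate left inverses on neighbourhoods of K survive perturbation and force injectivity on
K, which gives univalence of every iterate. -/

namespace EntireDynamics

open Metric

/-! ### Peak functions and approximate left inverses -/

/-- A compact plane set with connected complement is polynomially convex. -/
theorem exists_entire_peak {K : Set ℂ} (hK : IsCompact K) (hKc : IsPreconnected Kᶜ) {p : ℂ}
    (hp : p ∉ K) :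
    ∃ g : ℂ → ℂ, Differentiable ℂ g ∧ g p = 1 ∧ ∀ z ∈ K, ‖g z‖ < 1 := by
  have : CompactSpace K := isCompact_iff_compactSpace.mp hK
  let S : Subalgebra ℂ C(K, ℂ) := (polynomialFunctions K).topologicalClosure
  have hSc : IsClosed (S : Set C(K, ℂ)) := Subalgebra.isClosed_topologicalClosure _
  let X : C(K, ℂ) := Polynomial.toContinuousMapOn Polynomial.X K
  have hX : ∀ z : K, X z = z := fun z => by simp [X]
  have hXS : X ∈ S := Subalgebra.le_topologicalClosure _ ⟨Polynomial.X, trivial, rfl⟩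
  have hspec : spectrum ℂ X = K := by
    rw [ContinuousMap.spectrum_eq_range]
    ext z
    constructor
    · rintro ⟨w, rfl⟩
      rw [hX]
      exact w.2
    · intro hz
      exact ⟨⟨z, hz⟩, hX _⟩
  -- Passing to a closed subalgebra can only fill holes of the spectrum, and K has none. Hence p - X
  -- is already invertible in the closure of the polynomials.
  have hspecS : spectrum ℂ (⟨X, hXS⟩ : S) = K := by
    have : IsClosed (S : Set C(K, ℂ)) := hSc
    refine (Subalgebra.spectrum_eq_of_isPreconnected_compl S (⟨X, hXS⟩ : S) ?_).trans hspec
    change IsPreconnected (spectrum ℂ X)ᶜ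
    rwa [hspec]
  have hunit : IsUnit (algebraMap ℂ S p - ⟨X, hXS⟩) := by
    rw [← spectrum.notMem_iff, hspecS]
    exact hp
  obtain ⟨v, hv⟩ := hunit.exists_right_inv
  have hv' : ∀ z : K, (p - z) * (v : C(K, ℂ)) z = 1 := by
    intro z
    have h1 := congrArg (fun s : S => (s : C(K, ℂ)) z) hv
    simpa [hX] using h1
  obtain ⟨M, hM0, hM⟩ : ∃ M > 0, ∀ z ∈ K, ‖p - z‖ ≤ M := by
    obtain ⟨M, hM⟩ := hK.exists_bound_of_continuousOn
      (f := fun z => p - z) (by fun_prop)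
    exact ⟨max M 1, by positivity, fun z hz => (hM z hz).trans (le_max_left _ _)⟩
  have hvcl : (v : C(K, ℂ)) ∈ closure (polynomialFunctions K : Set C(K, ℂ)) := v.2
  obtain ⟨q, ⟨P, -, rfl⟩, hq⟩ := Metric.mem_closure_iff.mp hvcl (1 / M) (by positivity)
  -- P approximates 1 / (p - z) on K to within 1 / M, so this is small on K, yet equals 1 at p.
  refine ⟨fun z => 1 - (p - z) * P.eval z, by fun_prop, by simp, fun z hz => ?_⟩
  have h2 := (ContinuousMap.dist_apply_le_dist (⟨z, hz⟩ : K)).trans_lt hq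
  have h3 : ‖(v : C(K, ℂ)) ⟨z, hz⟩ - P.eval z‖ < 1 / M := by
    simpa [dist_eq_norm] using h2
  have h4 : 1 - (p - z) * P.eval z = (p - z) * ((v : C(K, ℂ)) ⟨z, hz⟩ - P.eval z) := by
    rw [mul_sub, hv' ⟨z, hz⟩]
  simp only [h4, norm_mul]
  calc _ ≤ M * ‖(v : C(K, ℂ)) ⟨z, hz⟩ - P.eval z‖ := by gcongr; exact hM z hz
    _ < M * (1 / M) := by gcongr
    _ = 1 := by field_simp

theorem exists_dist_lt_of_isCompact {f : ℂ → ℂ} (hf : Continuous f) {C : Set ℂ} (hC : IsCompact C)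
    {ε : ℝ} (hε : 0 < ε) :
    ∃ d > 0, ∀ z ∈ C, ∀ w, ‖w - z‖ < d → ‖f w - f z‖ < ε := by
  have h := hC.uniformContinuousAt_of_continuousAt f (fun a _ => hf.continuousAt)
    (Metric.dist_mem_uniformity hε)
  obtain ⟨d, hd, h⟩ := Metric.mem_uniformity_dist.mp h
  refine ⟨d, hd, fun z hz w hw => ?_⟩
  have : dist (f z) (f w) < ε := h (a := z) (b := w) (by rwa [dist_comm, dist_eq_norm]) hz
  rwa [dist_comm, dist_eq_norm] at this

/-- An approximate entire left inverse of an entire map can be improved, on a smaller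
neighbourhood, to one of any prescribed precision. -/
theorem exists_entire_left_inverse {K : Set ℂ} {δ : ℝ} (hδ : 0 < δ) {φ h : ℂ → ℂ}
    (hφ : Differentiable ℂ φ) (hh : Differentiable ℂ h)
    (hφh : ∀ z ∈ cthickening δ K, ‖h (φ z) - z‖ ≤ δ / 8) {e : ℝ} (he : 0 < e) :
    ∃ H : ℂ → ℂ, Differentiable ℂ H ∧ ∀ z ∈ cthickening (δ / 2) K, ‖H (φ z) - z‖ < e := by
  let u : ℂ → ℂ := fun z => h (φ z) - z
  have hu : Differentiable ℂ u := (hh.comp hφ).sub differentiable_id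
  have hsub : ∀ z ∈ cthickening (δ / 2) K, ∀ w, ‖w - z‖ ≤ δ / 2 → w ∈ cthickening δ K := by
    intro z hz w hw
    have h1 : w ∈ cthickening (δ / 2) (cthickening (δ / 2) K) :=
      mem_cthickening_of_dist_le w z _ _ hz (by rwa [dist_eq_norm])
    have h2 := cthickening_cthickening_subset (by positivity : (0 : ℝ) ≤ δ / 2)
      (by positivity : (0 : ℝ) ≤ δ / 2) K h1
    rwa [add_halves] at h2
  have hlip : ∀ z ∈ cthickening (δ / 2) K, ∀ w, ‖w - z‖ ≤ δ / 4 →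
      ‖u w - u z‖ ≤ 1 / 2 * ‖w - z‖ := by
    intro z hz w hw
    refine (convex_closedBall z (δ / 4)).norm_image_sub_le_of_norm_deriv_le (𝕜 := ℂ)
      (fun x _ => hu x) (fun x hx => ?_) (mem_closedBall_self (by positivity))
      (by rwa [mem_closedBall, dist_eq_norm])
    -- Cauchy's estimate on a circle of radius δ / 4, which stays within δ / 2 of z.
    have h1 : ‖deriv u x‖ ≤ (δ / 8) / (δ / 4) := by
      refine Complex.norm_deriv_le_of_forall_mem_sphere_norm_le (by positivity)
        hu.diffContOnCl fun y hy => hφh y (hsub z hz y ?_)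
      rw [mem_closedBall, dist_eq_norm] at hx
      rw [mem_sphere, dist_eq_norm] at hy
      calc ‖y - z‖ = ‖(y - x) + (x - z)‖ := by ring_nf
        _ ≤ ‖y - x‖ + ‖x - z‖ := norm_add_le _ _
        _ ≤ δ / 2 := by linarith
    refine h1.trans (le_of_eq ?_)
    field_simp
    norm_num
  -- For y = h (φ z), the point z is a fixed point of w ↦ y - u w, a map that halves distances to z.
  -- Finitely many iterations keep the left inverse entire.
  let E : ℕ → ℂ → ℂ := fun n => Nat.rec (fun y => y) (fun _ F y => y - u (F y)) n
  have hE : ∀ n, Differentiable ℂ (E n) := by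
    intro n
    induction n with
    | zero => exact differentiable_id
    | succ n ih => exact differentiable_id.sub (hu.comp ih)
  have hbound : ∀ n, ∀ z ∈ cthickening (δ / 2) K,
      ‖E n (h (φ z)) - z‖ ≤ (1 / 2) ^ n * (δ / 8) := by
    intro n z hz
    induction n with
    | zero => simpa [E] using hφh z (hsub z hz z (by simp; positivity))
    | succ n ih =>
      have h1 : E (n + 1) (h (φ z)) - z = -(u (E n (h (φ z))) - u z) := by
        simp only [E, u]
        ring
      rw [h1, norm_neg]
      have h2 : (1 / 2 : ℝ) ^ n ≤ 1 := pow_le_one₀ (by norm_num) (by norm_num)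
      refine (hlip z hz _ (ih.trans ?_)).trans ?_
      · nlinarith
      · rw [pow_succ]
        nlinarith
  obtain ⟨n, hn⟩ := exists_pow_lt_of_lt_one (show 0 < e / (δ / 8) by positivity)
    (show (1 / 2 : ℝ) < 1 by norm_num)
  refine ⟨fun y => E n (h y), (hE n).comp hh, fun z hz => (hbound n z hz).trans_lt ?_⟩
  rwa [lt_div_iff₀ (by positivity)] at hn

/-- If φ identified two points, a left inverse more precise than half their distance would be
contradictory. -/
theorem injOn_of_approximate_left_inverse {K : Set ℂ} {δ : ℝ} (hδ : 0 < δ) {φ h : ℂ → ℂ}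
    (hφ : Differentiable ℂ φ) (hh : Differentiable ℂ h)
    (hφh : ∀ z ∈ cthickening δ K, ‖h (φ z) - z‖ ≤ δ / 8) : InjOn φ K := by
  intro z hz w hw hzw
  by_contra hne
  have hpos : 0 < ‖z - w‖ := norm_pos_iff.mpr (sub_ne_zero.mpr hne)
  obtain ⟨H, -, hH⟩ := exists_entire_left_inverse hδ hφ hh hφh (half_pos hpos)
  have h1 := hH z (self_subset_cthickening K hz)
  have h2 := hH w (self_subset_cthickening K hw)
  rw [hzw] at h1
  have h3 : z - w = (H (φ w) - w) - (H (φ w) - z) := by ring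
  have h4 := norm_sub_le (H (φ w) - w) (H (φ w) - z)
  rw [← h3] at h4
  linarith

/-! ### Approximation on two discs, perturbed iterates, separation -/

/-- Entire functions on two well separated discs can be approximated simultaneously. -/
theorem exists_entire_approx_two_discs {f F : ℂ → ℂ} (hf : Differentiable ℂ f)
    (hF : Differentiable ℂ F) {a c : ℂ} {R ρ : ℝ} (hac : c ≠ a) (hR : R ≤ ‖c - a‖ / 5)
    (hρ : ρ ≤ ‖c - a‖ / 5) {η : ℝ} (hη : 0 < η) :
    ∃ f' : ℂ → ℂ, Differentiable ℂ f' ∧ (∀ z ∈ closedBall a R, ‖f' z - f z‖ ≤ η) ∧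
      ∀ z ∈ closedBall c ρ, ‖f' z - F z‖ ≤ η := by
  have hca : 0 < ‖c - a‖ := norm_pos_iff.mpr (sub_ne_zero.mpr hac)
  -- This cubic has superattracting fixed points 0 and 1, exchanged by the symmetry z ↦ 1 - z. Its
  -- iterates approximate a locally constant cutoff on the discs of radius 1/5 about 0 and 1.
  let s : ℂ → ℂ := fun z => 3 * z ^ 2 - 2 * z ^ 3
  have hs : Differentiable ℂ s := by fun_prop
  have hs0 : ∀ z, ‖z‖ ≤ 1 / 5 → ‖s z‖ ≤ 7 / 10 * ‖z‖ := by
    intro z hz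
    have h1 : s z = z * (z * (3 - 2 * z)) := by simp only [s]; ring
    have h2 : ‖(3 : ℂ) - 2 * z‖ ≤ 3 + 2 * ‖z‖ := by
      refine (norm_sub_le _ _).trans ?_
      simp
    rw [h1, norm_mul, norm_mul, mul_comm]
    gcongr
    calc ‖z‖ * ‖(3 : ℂ) - 2 * z‖ ≤ 1 / 5 * (3 + 2 * (1 / 5)) := by
          gcongr
          linarith
      _ ≤ 7 / 10 := by norm_num
  have hs1 : ∀ z, 1 - s z = s (1 - z) := by
    intro z
    simp only [s]
    ring
  have hit : ∀ n z, ‖z‖ ≤ 1 / 5 → ‖s^[n] z‖ ≤ (7 / 10) ^ n * (1 / 5) := by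
    intro n z hz
    induction n with
    | zero => simpa using hz
    | succ n ih =>
      rw [Function.iterate_succ_apply']
      have h2 : (7 / 10 : ℝ) ^ n ≤ 1 := pow_le_one₀ (by norm_num) (by norm_num)
      refine (hs0 _ (ih.trans (by linarith))).trans ?_
      rw [pow_succ]
      linarith
  have hit1 : ∀ n z, 1 - s^[n] z = s^[n] (1 - z) := by
    intro n z
    induction n with
    | zero => simp
    | succ n ih => rw [Function.iterate_succ_apply', Function.iterate_succ_apply', ← ih, hs1]
  obtain ⟨B, hB⟩ := (isCompact_closedBall a R |>.union (isCompact_closedBall c ρ)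
    ).exists_bound_of_continuousOn (f := fun z => F z - f z)
    (hF.continuous.sub hf.continuous).continuousOn
  obtain ⟨n, hn⟩ := exists_pow_lt_of_lt_one (show 0 < η / (|B| + 1) by positivity)
    (show (7 / 10 : ℝ) < 1 by norm_num)
  rw [lt_div_iff₀ (by positivity)] at hn
  have hn0 : (0 : ℝ) < (7 / 10) ^ n := by positivity
  have hsmall : ∀ x y : ℂ, ‖x‖ ≤ B → ‖y‖ ≤ (7 / 10) ^ n * (1 / 5) → ‖x * y‖ ≤ η := by
    intro x y hx hy
    rw [norm_mul]
    calc ‖x‖ * ‖y‖ ≤ (|B| + 1) * ((7 / 10) ^ n * (1 / 5)) := by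
          gcongr
          linarith [le_abs_self B]
      _ ≤ η := by nlinarith [abs_nonneg B]
  refine ⟨fun z => f z + (F z - f z) * s^[n] ((z - a) / (c - a)), ?_, fun z hz => ?_,
    fun z hz => ?_⟩
  · exact hf.add ((hF.sub hf).mul ((hs.iterate n).comp (by fun_prop)))
  · simp only [add_sub_cancel_left]
    refine hsmall _ _ (hB z (Or.inl hz)) (hit n _ ?_)
    rw [norm_div, div_le_iff₀ hca]
    rw [mem_closedBall, dist_eq_norm] at hz
    linarith
  · have h1 : f z + (F z - f z) * s^[n] ((z - a) / (c - a)) - F z =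
        (F z - f z) * -(1 - s^[n] ((z - a) / (c - a))) := by ring
    simp only [h1]
    refine hsmall _ _ (hB z (Or.inr hz)) ?_
    rw [norm_neg, hit1]
    apply hit
    have h2 : 1 - (z - a) / (c - a) = (c - z) / (c - a) := by
      field_simp [sub_ne_zero.mpr hac]
      ring
    rw [h2, norm_div, div_le_iff₀ hca, norm_sub_rev]
    rw [mem_closedBall, dist_eq_norm] at hz
    linarith

/-- Iterates depend continuously on the map along orbits that stay inside a disc. -/
theorem exists_iterate_close {f : ℂ → ℂ} (hf : Continuous f) {a : ℂ} {R : ℝ} {A : Set ℂ} (k : ℕ)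
    (hA : ∀ j < k, ∀ z ∈ A, f^[j] z ∈ closedBall a (R - 1)) {τ : ℝ} (hτ : 0 < τ) :
    ∃ η > 0, ∀ g : ℂ → ℂ, (∀ w ∈ closedBall a R, ‖g w - f w‖ ≤ η) →
      ∀ z ∈ A, ‖g^[k] z - f^[k] z‖ < τ := by
  induction k generalizing τ with
  | zero => exact ⟨1, one_pos, fun g _ z _ => by simpa using hτ⟩
  | succ k ih =>
    obtain ⟨d, hd, hfd⟩ := exists_dist_lt_of_isCompact hf (isCompact_closedBall a R)
      (half_pos hτ)
    -- The bound 1 matches the margin in `hA`: the perturbed orbit stays in the disc of radius R,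
    -- where g is controlled.
    obtain ⟨η, hη, hg⟩ := ih (fun j hj => hA j (hj.trans (Nat.lt_succ_self k)))
      (lt_min hd one_pos)
    refine ⟨min η (τ / 2), lt_min hη (half_pos hτ), fun g hgf z hz => ?_⟩
    have h1 := hg g (fun w hw => (hgf w hw).trans (min_le_left _ _)) z hz
    have h2 := hA k (Nat.lt_succ_self k) z hz
    have h3 : f^[k] z ∈ closedBall a R := closedBall_subset_closedBall (by linarith) h2
    have h4 : g^[k] z ∈ closedBall a R := by
      rw [mem_closedBall, dist_eq_norm] at h2 ⊢
      have h5 : g^[k] z - a = (g^[k] z - f^[k] z) + (f^[k] z - a) := by ring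
      rw [h5]
      linarith [norm_add_le (g^[k] z - f^[k] z) (f^[k] z - a), h1.trans_le (min_le_right _ _)]
    rw [Function.iterate_succ_apply', Function.iterate_succ_apply']
    have h6 := hfd _ h3 _ (h1.trans_le (min_le_left _ _))
    have h7 := (hgf _ h4).trans (min_le_right _ _)
    have h8 : g (g^[k] z) - f (f^[k] z) =
        (g (g^[k] z) - f (g^[k] z)) + (f (g^[k] z) - f (f^[k] z)) := by ring
    rw [h8]
    linarith [norm_add_le (g (g^[k] z) - f (g^[k] z)) (f (g^[k] z) - f (f^[k] z))]

/-- After an entire map with an approximate entire left inverse, one can follow a prescribed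
map `T` near `K` while sending the image of an exceptional point close to `0`. -/
theorem exists_entire_separating {K : Set ℂ} (hK : IsCompact K) {δ δ' : ℝ} (hδ : 0 < δ)
    (hδ' : δ' ≤ δ / 2) {φ h T g : ℂ → ℂ} (hφ : Differentiable ℂ φ) (hh : Differentiable ℂ h)
    (hT : Differentiable ℂ T) (hg : Differentiable ℂ g)
    (hφh : ∀ z ∈ cthickening δ K, ‖h (φ z) - z‖ ≤ δ / 8) {p : ℂ}
    (hp : p ∈ cthickening (δ / 2) K) (hgp : g p = 1) (hgK : ∀ z ∈ cthickening δ' K, ‖g z‖ < 1)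
    {τ : ℝ} (hτ : 0 < τ) :
    ∃ F : ℂ → ℂ, Differentiable ℂ F ∧ (∀ z ∈ cthickening δ' K, ‖F (φ z) - T (φ z)‖ < τ) ∧
      ‖F (φ p)‖ < τ := by
  have hcpt : IsCompact (cthickening (δ / 2) K) := hK.cthickening
  have hcpt' : IsCompact (cthickening δ' K) := hK.cthickening
  have hsub : cthickening δ' K ⊆ cthickening (δ / 2) K := cthickening_mono hδ' K
  obtain ⟨B, hB⟩ := hcpt.exists_bound_of_continuousOn (f := fun z => T (φ z))
    (hT.continuous.comp hφ.continuous).continuousOn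
  have hB1 : 0 < |B| + 1 := by positivity
  obtain ⟨q, hq0, hq1, hq⟩ : ∃ q : ℝ, 0 ≤ q ∧ q < 1 ∧ ∀ z ∈ cthickening δ' K, ‖g z‖ ≤ q := by
    rcases (cthickening δ' K).eq_empty_or_nonempty with h0 | h0
    · exact ⟨0, le_rfl, one_pos, by simp [h0]⟩
    · obtain ⟨z₀, hz₀, hmax⟩ := hcpt'.exists_isMaxOn h0 hg.continuous.norm.continuousOn
      exact ⟨‖g z₀‖, norm_nonneg _, hgK z₀ hz₀, fun z hz => hmax hz⟩
  have hε : 0 < τ / (2 * (|B| + 1)) := by positivity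
  obtain ⟨n, hn⟩ := exists_pow_lt_of_lt_one hε hq1
  -- The precision required of H depends on n, hence the need for left inverses of arbitrary
  -- accuracy.
  obtain ⟨d, hd, hgd⟩ := exists_dist_lt_of_isCompact (hg.pow n).continuous hcpt hε
  obtain ⟨H, hH, hHφ⟩ := exists_entire_left_inverse hδ hφ hh hφh hd
  have hsmall : ∀ z ∈ cthickening (δ / 2) K, ∀ y : ℂ, ‖y‖ < 2 * (τ / (2 * (|B| + 1))) →
      ‖T (φ z) * y‖ < τ := by
    intro z hz y hy
    rw [norm_mul]
    calc ‖T (φ z)‖ * ‖y‖ ≤ (|B| + 1) * ‖y‖ := by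
          gcongr
          linarith [hB z hz, le_abs_self B]
      _ < (|B| + 1) * (2 * (τ / (2 * (|B| + 1)))) := by gcongr
      _ = τ := by field_simp
  -- The second factor is nearly 1 on the image of the smaller neighbourhood and nearly 0 at φ p.
  refine ⟨fun w => T w * (1 - g (H w) ^ n), ?_, fun z hz => ?_, ?_⟩
  · exact hT.mul ((differentiable_const _).sub ((hg.comp hH).pow n))
  · have h1 : T (φ z) * (1 - g (H (φ z)) ^ n) - T (φ z) = T (φ z) * -(g (H (φ z)) ^ n) := by ring
    simp only [h1]
    refine hsmall z (hsub hz) _ ?_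
    have h2 : ‖g (H (φ z)) ^ n - g z ^ n‖ < _ := hgd z (hsub hz) _ (hHφ z (hsub hz))
    have h3 : ‖g z ^ n‖ ≤ q ^ n := by
      rw [norm_pow]
      exact pow_le_pow_left₀ (norm_nonneg _) (hq z hz) n
    have h4 := norm_add_le (g (H (φ z)) ^ n - g z ^ n) (g z ^ n)
    rw [sub_add_cancel] at h4
    rw [norm_neg]
    linarith
  · refine hsmall p hp _ ?_
    have h2 : ‖g (H (φ p)) ^ n - g p ^ n‖ < _ := hgd p hp _ (hHφ p hp)
    rw [hgp, one_pow, norm_sub_rev] at h2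
    linarith

/-! ### The discs and the inductive construction -/

/-- A sequence of shrinking neighbourhoods `cthickening (δ k) K` of `K` with points `p k` of the
`k`-th one that a peaking entire function separates from the next one. -/
structure ShrinkingData (K : Set ℂ) where
  ρ : ℝ
  one_le_ρ : 1 ≤ ρ
  δ : ℕ → ℝ
  δ_pos : ∀ k, 0 < δ k
  δ_succ_le : ∀ k, δ (k + 1) ≤ δ k / 2
  subset_closedBall : cthickening (δ 0) K ⊆ closedBall 0 ρ
  p : ℕ → ℂ
  p_mem : ∀ k, p k ∈ cthickening (δ k / 2) K
  g : ℕ → ℂ → ℂ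
  differentiable_g : ∀ k, Differentiable ℂ (g k)
  g_p : ∀ k, g k (p k) = 1
  norm_g_lt : ∀ k, ∀ z ∈ cthickening (δ (k + 1)) K, ‖g k z‖ < 1

namespace ShrinkingData

variable {K : Set ℂ} (D : ShrinkingData K)

/-- The `k`-th neighbourhood of `K`. -/
def nhd (k : ℕ) : Set ℂ := cthickening (D.δ k) K

/-- The common centre of the exhausting discs. -/
def base : ℂ := ((-5 * D.ρ : ℝ) : ℂ)

/-- The radii of the exhausting discs. -/
def radius (k : ℕ) : ℝ := D.ρ * 7 ^ k

/-- The centres of the discs of radius `ρ` that the orbit of `K` visits. -/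
def center (k : ℕ) : ℂ := D.base + ((5 * D.ρ * 7 ^ k : ℝ) : ℂ)

theorem ρ_pos : 0 < D.ρ := one_pos.trans_le D.one_le_ρ

theorem nhd_succ_subset (k : ℕ) : D.nhd (k + 1) ⊆ D.nhd k :=
  cthickening_mono ((D.δ_succ_le k).trans (by linarith [D.δ_pos k])) K

theorem p_mem_nhd (k : ℕ) : D.p k ∈ D.nhd k :=
  cthickening_mono (by linarith [D.δ_pos k]) K (D.p_mem k)

theorem center_zero : D.center 0 = 0 := by
  simp [center, base]

theorem norm_center_sub_base (k : ℕ) : ‖D.center k - D.base‖ = 5 * D.ρ * 7 ^ k := by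
  have := D.ρ_pos
  rw [center, add_sub_cancel_left, Complex.norm_real, Real.norm_of_nonneg (by positivity)]

theorem seven_pow_lt {j k : ℕ} (h : j < k) : (7 : ℝ) * 7 ^ j ≤ 7 ^ k := by
  rw [← pow_succ']
  exact pow_le_pow_right₀ (by norm_num) h

/-- The ratio 7 leaves room: 5ρ·7^j + ρ ≤ ρ·7^(j+1) - 1 because ρ ≥ 1. The margin 1 is the one
needed in `exists_iterate_close`. -/
theorem closedBall_center_subset {j k : ℕ} (h : j < k) :
    closedBall (D.center j) D.ρ ⊆ closedBall D.base (D.radius k - 1) := by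
  refine closedBall_subset_closedBall' ?_
  rw [dist_eq_norm, norm_center_sub_base, radius]
  have h1 := seven_pow_lt h
  have h2 : (1 : ℝ) ≤ 7 ^ j := one_le_pow₀ (by norm_num)
  nlinarith [D.one_le_ρ]

theorem disjoint_closedBall_center {j k : ℕ} (h : j < k) :
    Disjoint (closedBall (D.center j) D.ρ) (closedBall (D.center k) D.ρ) := by
  refine closedBall_disjoint_closedBall ?_
  rw [dist_comm, dist_eq_norm]
  have h1 := seven_pow_lt h
  have h2 : (1 : ℝ) ≤ 7 ^ j := one_le_pow₀ (by norm_num)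
  have h3 := norm_sub_norm_le (D.center k - D.base) (D.center j - D.base)
  rw [norm_center_sub_base, norm_center_sub_base, sub_sub_sub_cancel_right] at h3
  nlinarith [D.one_le_ρ]

theorem norm_of_mem_closedBall_center {k : ℕ} {z : ℂ} (hz : z ∈ closedBall (D.center k) D.ρ) :
    5 * D.ρ * 7 ^ k - 6 * D.ρ ≤ ‖z‖ := by
  have h1 := norm_center_sub_base D k
  have h2 : ‖D.base‖ = 5 * D.ρ := by
    have := D.ρ_pos
    rw [base, Complex.norm_real, Real.norm_eq_abs, abs_of_nonpos (by linarith)]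
    ring
  rw [mem_closedBall, dist_eq_norm, norm_sub_rev] at hz
  have h3 := norm_add_le (D.center k - z) z
  rw [sub_add_cancel] at h3
  linarith [norm_sub_le (D.center k) D.base]

theorem radius_mono {j k : ℕ} (h : j ≤ k) : D.radius j ≤ D.radius k := by
  have := D.ρ_pos
  unfold radius
  gcongr
  norm_num

/-- `g` carries the `k`-th neighbourhood of `K` along the first `k` discs with approximate left
inverse `h`, and the points `p j` with `j < k` return to the unit disc. -/
def IsTracking (k : ℕ) (h g : ℂ → ℂ) : Prop :=
  (∀ j ≤ k, ∀ z ∈ D.nhd k, g^[j] z ∈ closedBall (D.center j) D.ρ) ∧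
    (∀ z ∈ D.nhd k, ‖h (g^[k] z) - z‖ ≤ D.δ k / 8) ∧ ∀ j < k, ‖g^[j + 1] (D.p j)‖ ≤ 1

/-- Every map that is `η`-close to `f` on the `k`-th exhausting disc is tracking. -/
structure IsStage (k : ℕ) (f h : ℂ → ℂ) (η : ℝ) : Prop where
  differentiable : Differentiable ℂ f
  differentiable_inv : Differentiable ℂ h
  pos : 0 < η
  isTracking : ∀ g : ℂ → ℂ, (∀ w ∈ closedBall D.base (D.radius k), ‖g w - f w‖ ≤ η) →
    D.IsTracking k h g

theorem isStage_zero : D.IsStage 0 id id 1 where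
  differentiable := differentiable_id
  differentiable_inv := differentiable_id
  pos := one_pos
  isTracking := by
    refine fun g _ => ⟨fun j hj z hz => ?_, fun z hz => ?_, fun j hj => absurd hj (Nat.not_lt_zero j)⟩
    · obtain rfl := Nat.le_zero.mp hj
      rw [center_zero]
      exact D.subset_closedBall hz
    · have := D.δ_pos 0
      simp
      positivity

/-- The first k iterates only use f on the k-th exhausting disc, while f^k(K) lies in a disc well
away from it. There the next map can be prescribed almost freely. -/
theorem exists_isStage_succ (hK : IsCompact K) {k : ℕ} {f h : ℂ → ℂ} {η : ℝ}
    (hf : D.IsStage k f h η) :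
    ∃ (f' h' : ℂ → ℂ) (η' : ℝ), D.IsStage (k + 1) f' h' η' ∧ η' ≤ η / 2 ∧
      ∀ w ∈ closedBall D.base (D.radius k), ‖f' w - f w‖ ≤ η / 2 := by
  have hη := hf.pos
  have hρ := D.ρ_pos
  have hρ1 := D.one_le_ρ
  have hδ := D.δ_pos (k + 1)
  obtain ⟨horb, hinv, -⟩ := hf.isTracking f (fun w _ => by simpa using hη.le)
  have hφ : Differentiable ℂ f^[k] := hf.differentiable.iterate k
  -- Three errors of δ (k + 1) / 32 occur: from H, from f' versus T, and from g versus f'. Their sum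
  -- is below δ (k + 1) / 8.
  obtain ⟨H, hH, hHφ⟩ := exists_entire_left_inverse (D.δ_pos k) hφ hf.differentiable_inv hinv
    (e := D.δ (k + 1) / 32) (by positivity)
  -- Halving puts the image in the disc of radius ρ / 2, leaving at least 1/2 for the two later
  -- errors of at most 1/4.
  let T : ℂ → ℂ := fun w => D.center (k + 1) + (w - D.center k) / 2
  have hT : Differentiable ℂ T := by fun_prop
  let h' : ℂ → ℂ := fun w => H (D.center k + 2 * (w - D.center (k + 1)))
  have hh' : Differentiable ℂ h' := hH.comp (by fun_prop)
  have hh'T : ∀ w, h' (T w) = H w := by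
    intro w
    simp only [h', T]
    congr 1
    ring
  have hcpt : IsCompact (D.nhd (k + 1)) := hK.cthickening
  obtain ⟨d, hd, hdh'⟩ := exists_dist_lt_of_isCompact hh'.continuous
    (hcpt.image (hT.comp hφ).continuous) (ε := D.δ (k + 1) / 32) (by positivity)
  obtain ⟨τ, hτ, hτd, hτ1⟩ : ∃ τ > 0, 3 * τ ≤ d ∧ 3 * τ ≤ 1 / 4 :=
    ⟨min d (1 / 4) / 3, by positivity, by linarith [min_le_left d (1 / 4)],
      by linarith [min_le_right d (1 / 4)]⟩
  obtain ⟨F, hF, hFT, hFp⟩ := exists_entire_separating hK (D.δ_pos k) (D.δ_succ_le k) hφ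
    hf.differentiable_inv hT (D.differentiable_g k) hinv (D.p_mem k) (D.g_p k) (D.norm_g_lt k) hτ
  obtain ⟨d₂, hd₂, hFd₂⟩ := exists_dist_lt_of_isCompact hF.continuous
    (isCompact_closedBall (D.center k) D.ρ) hτ
  obtain ⟨η₁, hη₁, hclose⟩ := exists_iterate_close hf.differentiable.continuous k
    (fun j hj z hz => D.closedBall_center_subset hj (horb j hj.le z hz)) hd₂
  have hcb : 0 < ‖D.center k - D.base‖ := by rw [norm_center_sub_base]; positivity
  obtain ⟨f', hf', hf'f, hf'F⟩ := exists_entire_approx_two_discs hf.differentiable hF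
    (sub_ne_zero.mp (norm_pos_iff.mp hcb)) (R := D.radius k) (ρ := D.ρ)
    (by rw [norm_center_sub_base, radius]; apply le_of_eq; ring)
    (by
      rw [norm_center_sub_base]
      have : (1 : ℝ) ≤ 7 ^ k := one_le_pow₀ (by norm_num)
      nlinarith)
    (show 0 < min (min (η / 2) η₁) τ by positivity)
  have hf'η : ∀ w ∈ closedBall D.base (D.radius k), ‖f' w - f w‖ ≤ η / 2 := fun w hw =>
    (hf'f w hw).trans ((min_le_left _ _).trans (min_le_left _ _))
  obtain ⟨horb', -, -⟩ := hf.isTracking f' fun w hw => (hf'η w hw).trans (by linarith)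
  have hf'k : ∀ z ∈ D.nhd k, ‖f'^[k + 1] z - F (f^[k] z)‖ < 2 * τ := by
    intro z hz
    have h1 := hclose f' (fun w hw => (hf'f w hw).trans
      ((min_le_left _ _).trans (min_le_right _ _))) z hz
    have h2 := hFd₂ _ (horb k le_rfl z hz) _ h1
    have h3 := (hf'F _ (horb' k le_rfl z hz)).trans (min_le_right _ _)
    rw [Function.iterate_succ_apply']
    have h4 := norm_add_le (f' (f'^[k] z) - F (f'^[k] z)) (F (f'^[k] z) - F (f^[k] z))
    rw [sub_add_sub_cancel] at h4
    linarith
  have hf'T : ∀ z ∈ D.nhd (k + 1), ‖f'^[k + 1] z - T (f^[k] z)‖ < 3 * τ := by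
    intro z hz
    have h1 := hf'k z (D.nhd_succ_subset k hz)
    have h2 := hFT z hz
    have h4 := norm_add_le (f'^[k + 1] z - F (f^[k] z)) (F (f^[k] z) - T (f^[k] z))
    rw [sub_add_sub_cancel] at h4
    linarith
  have hf'p : ‖f'^[k + 1] (D.p k)‖ < 3 * τ := by
    have h1 := hf'k _ (D.p_mem_nhd k)
    have h4 := norm_add_le (f'^[k + 1] (D.p k) - F (f^[k] (D.p k))) (F (f^[k] (D.p k)))
    rw [sub_add_cancel] at h4
    linarith
  obtain ⟨d₃, hd₃, hdh'₃⟩ := exists_dist_lt_of_isCompact hh'.continuous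
    (hcpt.image (hf'.iterate (k + 1)).continuous) (ε := D.δ (k + 1) / 32) (by positivity)
  -- Closeness is needed on the k-th neighbourhood, not just the next one, since it contains the
  -- point p k.
  obtain ⟨η₃, hη₃, hclose'⟩ := exists_iterate_close hf'.continuous (A := D.nhd k) (k + 1)
    (fun j hj z hz => D.closedBall_center_subset hj (horb' j (Nat.lt_succ_iff.mp hj) z hz))
    (show 0 < min d₃ (1 / 4) by positivity)
  refine ⟨f', h', min η₃ (η / 2), ⟨hf', hh', by positivity, fun g hg => ?_⟩, min_le_right _ _,
    hf'η⟩
  have hgk : ∀ w ∈ closedBall D.base (D.radius k), ‖g w - f w‖ ≤ η := by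
    intro w hw
    have h1 := (hg w (closedBall_subset_closedBall (D.radius_mono k.le_succ) hw)).trans
      (min_le_right _ _)
    have h2 := hf'η w hw
    have h4 := norm_add_le (g w - f' w) (f' w - f w)
    rw [sub_add_sub_cancel] at h4
    linarith
  obtain ⟨gorb, -, gp⟩ := hf.isTracking g hgk
  have hgf' := hclose' g fun w hw => (hg w hw).trans (min_le_left _ _)
  refine ⟨fun j hj z hz => ?_, fun z hz => ?_, fun j hj => ?_⟩
  · rcases Nat.le_succ_iff.mp hj with hj | rfl
    · exact gorb j hj z (D.nhd_succ_subset k hz)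
    · have h1 := (hgf' z (D.nhd_succ_subset k hz)).trans_le (min_le_right _ _)
      have h2 := hf'T z hz
      have h3 : ‖T (f^[k] z) - D.center (k + 1)‖ ≤ D.ρ / 2 := by
        have h4 := horb k le_rfl z (D.nhd_succ_subset k hz)
        rw [mem_closedBall, dist_eq_norm] at h4
        simp only [T, add_sub_cancel_left, norm_div, Complex.norm_ofNat]
        linarith
      have h5 := norm_add_le (g^[k + 1] z - f'^[k + 1] z) (f'^[k + 1] z - T (f^[k] z))
      have h6 := norm_add_le (g^[k + 1] z - T (f^[k] z)) (T (f^[k] z) - D.center (k + 1))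
      rw [sub_add_sub_cancel] at h5 h6
      rw [mem_closedBall, dist_eq_norm]
      change ‖g^[k + 1] z - D.center (k + 1)‖ ≤ _
      linarith
  · have h1 := hdh'₃ _ (mem_image_of_mem _ hz) _
      ((hgf' z (D.nhd_succ_subset k hz)).trans_le (min_le_left _ _))
    have h2 := hdh' _ (mem_image_of_mem _ hz) _ ((hf'T z hz).trans_le hτd)
    have h3 := hHφ z (cthickening_mono (D.δ_succ_le k) K hz)
    simp only [Function.comp_apply, hh'T] at h2
    have h5 := norm_add_le (h' (g^[k + 1] z) - h' (f'^[k + 1] z))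
      (h' (f'^[k + 1] z) - H (f^[k] z))
    have h6 := norm_add_le (h' (g^[k + 1] z) - H (f^[k] z)) (H (f^[k] z) - z)
    rw [sub_add_sub_cancel] at h5 h6
    linarith
  · rcases Nat.lt_succ_iff_lt_or_eq.mp hj with hj | rfl
    · exact gp j hj
    · have h1 := (hgf' _ (D.p_mem_nhd j)).trans_le (min_le_right _ _)
      have h4 := norm_add_le (g^[j + 1] (D.p j) - f'^[j + 1] (D.p j)) (f'^[j + 1] (D.p j))
      rw [sub_add_cancel] at h4
      linarith

theorem exists_entire_isTracking (hK : IsCompact K) :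
    ∃ f : ℂ → ℂ, Differentiable ℂ f ∧
      ∀ k, ∃ h : ℂ → ℂ, Differentiable ℂ h ∧ D.IsTracking k h f := by
  let σ : ℕ → Type := fun k =>
    {s : (ℂ → ℂ) × (ℂ → ℂ) × ℝ // D.IsStage k s.1 s.2.1 s.2.2}
  have hnext : ∀ k (s : σ k), ∃ s' : σ (k + 1), s'.1.2.2 ≤ s.1.2.2 / 2 ∧
      ∀ w ∈ closedBall D.base (D.radius k), ‖s'.1.1 w - s.1.1 w‖ ≤ s.1.2.2 / 2 := by
    intro k s
    obtain ⟨f', h', η', hs, h1, h2⟩ := D.exists_isStage_succ hK s.2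
    exact ⟨⟨(f', h', η'), hs⟩, h1, h2⟩
  choose next hη hfn using hnext
  let s : ∀ k, σ k := fun k => Nat.rec ⟨(id, id, 1), D.isStage_zero⟩ (fun k t => next k t) k
  let F : ℕ → ℂ → ℂ := fun k => (s k).1.1
  let η : ℕ → ℝ := fun k => (s k).1.2.2
  have hstage : ∀ k, D.IsStage k (F k) (s k).1.2.1 (η k) := fun k => (s k).2
  have hηs : ∀ k, η (k + 1) ≤ η k / 2 := fun k => hη k (s k)
  have hFs : ∀ k, ∀ w ∈ closedBall D.base (D.radius k), ‖F (k + 1) w - F k w‖ ≤ η k / 2 :=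
    fun k => hfn k (s k)
  have hηle : ∀ k, η k ≤ (1 / 2) ^ k := by
    intro k
    induction k with
    | zero => exact le_of_eq (by simp [η, s])
    | succ k ih =>
      rw [pow_succ]
      linarith [hηs k]
  -- Telescoping: η j / 2 ≤ η j - η (j + 1). So the limit stays within the tolerance η k of every
  -- stage.
  have hFF : ∀ k i, ∀ w ∈ closedBall D.base (D.radius k),
      ‖F (k + i) w - F k w‖ ≤ η k - η (k + i) := by
    intro k i w hw
    induction i with
    | zero => simp
    | succ i ih =>
      have h1 := hFs (k + i) w (closedBall_subset_closedBall (D.radius_mono (Nat.le_add_right k i)) hw)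
      have h2 := hηs (k + i)
      have h4 := norm_add_le (F (k + i + 1) w - F (k + i) w) (F (k + i) w - F k w)
      rw [sub_add_sub_cancel] at h4
      rw [← add_assoc]
      linarith
  have hFle : ∀ k m, k ≤ m → ∀ w ∈ closedBall D.base (D.radius k), ‖F m w - F k w‖ ≤ η k := by
    intro k m hkm w hw
    obtain ⟨i, rfl⟩ := Nat.exists_eq_add_of_le hkm
    linarith [hFF k i w hw, (hstage (k + i)).pos]
  have hsmall : ∀ ε > 0, ∃ k, ∀ m ≥ k, η m < ε := by
    intro ε hε
    obtain ⟨k, hk⟩ := exists_pow_lt_of_lt_one hε (show (1 / 2 : ℝ) < 1 by norm_num)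
    exact ⟨k, fun m hm => (hηle m).trans_lt
      ((pow_le_pow_of_le_one (by norm_num) (by norm_num) hm).trans_lt hk)⟩
  have hexh : ∀ w, ∃ k, w ∈ ball D.base (D.radius k) := by
    intro w
    have h1 : Tendsto (fun k : ℕ => D.radius k) atTop atTop :=
      (tendsto_pow_atTop_atTop_of_one_lt (by norm_num)).const_mul_atTop D.ρ_pos
    exact (h1.eventually_gt_atTop (dist w D.base)).exists
  have hlim : ∀ w, ∃ y, Tendsto (fun k => F k w) atTop (𝓝 y) := by
    intro w
    refine cauchySeq_tendsto_of_complete (Metric.cauchySeq_iff'.mpr fun ε hε => ?_)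
    obtain ⟨k, hk⟩ := hexh w
    obtain ⟨m, hm⟩ := hsmall ε hε
    refine ⟨max k m, fun n hn => ?_⟩
    rw [dist_eq_norm]
    exact (hFle _ n hn w (ball_subset_closedBall (ball_subset_ball
      (D.radius_mono (le_max_left k m)) hk))).trans_lt (hm _ (le_max_right k m))
  choose f hf using hlim
  have hfF : ∀ k, ∀ w ∈ closedBall D.base (D.radius k), ‖f w - F k w‖ ≤ η k := by
    intro k w hw
    refine le_of_tendsto ((hf w).sub_const (F k w)).norm ?_
    filter_upwards [eventually_ge_atTop k] with m hm using hFle k m hm w hw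
  have hloc : TendstoLocallyUniformlyOn F f atTop univ := by
    rw [Metric.tendstoLocallyUniformlyOn_iff]
    intro ε hε x _
    obtain ⟨k, hk⟩ := hexh x
    obtain ⟨m, hm⟩ := hsmall ε hε
    refine ⟨ball D.base (D.radius k), mem_nhdsWithin_of_mem_nhds (isOpen_ball.mem_nhds hk), ?_⟩
    filter_upwards [eventually_ge_atTop (max k m)] with n hn y hy
    rw [dist_eq_norm]
    exact (hfF n y (ball_subset_closedBall (ball_subset_ball
      (D.radius_mono ((le_max_left k m).trans hn)) hy))).trans_lt
      (hm _ ((le_max_right k m).trans hn))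
  refine ⟨f, ?_, fun k => ⟨(s k).1.2.1, (hstage k).differentiable_inv,
    (hstage k).isTracking f (hfF k)⟩⟩
  rw [← differentiableOn_univ]
  exact hloc.differentiableOn (Eventually.of_forall fun k =>
    (hstage k).differentiable.differentiableOn) isOpen_univ

end ShrinkingData

/-! ### Choice of the exceptional points -/

theorem exists_separated_point {K : Set ℂ} (hK : IsCompact K) (hKc : IsPreconnected Kᶜ) {x : ℂ}
    (hx : x ∈ frontier K) {δ : ℝ} (hδ : 0 < δ) :
    ∃ (p : ℂ) (g : ℂ → ℂ) (δ' : ℝ), dist p x < δ / 2 ∧ p ∈ cthickening (δ / 2) K ∧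
      Differentiable ℂ g ∧ g p = 1 ∧ 0 < δ' ∧ δ' ≤ δ / 2 ∧ ∀ z ∈ cthickening δ' K, ‖g z‖ < 1 := by
  rw [frontier_eq_closure_inter_closure, hK.isClosed.closure_eq] at hx
  obtain ⟨p, hp, hpx⟩ := Metric.mem_closure_iff.mp hx.2 (δ / 2) (half_pos hδ)
  rw [dist_comm] at hpx
  obtain ⟨g, hg, hgp, hgK⟩ := exists_entire_peak hK hKc hp
  obtain ⟨e, he, hesub⟩ := hK.exists_cthickening_subset_open
    (isOpen_lt hg.continuous.norm continuous_const) hgK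
  exact ⟨p, g, min e (δ / 2), hpx, mem_cthickening_of_dist_le p x _ K hx.1 hpx.le, hg, hgp,
    lt_min he (half_pos hδ), min_le_right _ _,
    fun z hz => hesub (cthickening_mono (min_le_left _ _) K hz)⟩

theorem exists_shrinkingData {K : Set ℂ} (hK : IsCompact K) (hKc : IsPreconnected Kᶜ)
    (hne : (frontier K).Nonempty) :
    ∃ D : ShrinkingData K, ∀ x ∈ frontier K, ∀ r > 0, ∀ n, ∃ k ≥ n, dist (D.p k) x < r := by
  have : Nonempty (frontier K) := hne.to_subtype
  -- Unpairing makes each term of the dense sequence recur at arbitrarily late stages, when δ k is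
  -- small.
  let x : ℕ → frontier K := fun k => TopologicalSpace.denseSeq (frontier K) (Nat.unpair k).1
  choose! p g δ' hpx hpK hg hgp hδ' hδ'le hgK using
    fun (y : frontier K) (δ : ℝ) (hδ : 0 < δ) => exists_separated_point hK hKc y.2 hδ
  let δ : ℕ → ℝ := fun k => Nat.rec 1 (fun k d => δ' (x k) d) k
  have hδ : ∀ k, 0 < δ k := by
    intro k
    induction k with
    | zero => exact one_pos
    | succ k ih => exact hδ' _ _ ih
  have hδle : ∀ k, δ (k + 1) ≤ δ k / 2 := fun k => hδ'le _ _ (hδ k)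
  obtain ⟨M, hM⟩ := (hK.cthickening (r := δ 0)).isBounded.subset_closedBall 0
  refine ⟨{ ρ := max M 1
            one_le_ρ := le_max_right _ _
            δ := δ
            δ_pos := hδ
            δ_succ_le := hδle
            subset_closedBall := hM.trans (closedBall_subset_closedBall (le_max_left _ _))
            p := fun k => p (x k) (δ k)
            p_mem := fun k => hpK _ _ (hδ k)
            g := fun k => g (x k) (δ k)
            differentiable_g := fun k => hg _ _ (hδ k)
            g_p := fun k => hgp _ _ (hδ k)
            norm_g_lt := fun k => hgK _ _ (hδ k) }, fun y hy r hr n => ?_⟩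
  have hδpow : ∀ k, δ k ≤ (1 / 2) ^ k := by
    intro k
    induction k with
    | zero => exact le_of_eq (by simp [δ])
    | succ k ih =>
      rw [pow_succ]
      linarith [hδle k]
  obtain ⟨m, hm⟩ := exists_pow_lt_of_lt_one hr (show (1 / 2 : ℝ) < 1 by norm_num)
  obtain ⟨i, hi⟩ := (TopologicalSpace.denseRange_denseSeq (frontier K)).exists_dist_lt ⟨y, hy⟩
    (half_pos hr)
  have hk : max n m ≤ Nat.pair i (max n m) := Nat.right_le_pair _ _
  refine ⟨Nat.pair i (max n m), (le_max_left _ _).trans hk, ?_⟩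
  have h1 := hpx (x (Nat.pair i (max n m))) _ (hδ (Nat.pair i (max n m)))
  have h2 : δ (Nat.pair i (max n m)) < r := (hδpow _).trans_lt
    ((pow_le_pow_of_le_one (by norm_num) (by norm_num) ((le_max_right n m).trans hk)).trans_lt hm)
  have h3 : dist y (x (Nat.pair i (max n m)) : ℂ) < r / 2 := by
    simpa [x, Subtype.dist_eq] using hi
  change dist (p _ _) y < r
  rw [dist_comm] at h3
  linarith [dist_triangle (p (x (Nat.pair i (max n m))) (δ (Nat.pair i (max n m))))
    (x (Nat.pair i (max n m)) : ℂ) y]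

/-! ### Normality and the Fatou set -/

theorem tendsto_iterateOn_infty {f : C(ℂ, ℂ)} {U : Set ℂ}
    (h : ∀ R : ℝ, ∀ᶠ n in atTop, ∀ z ∈ U, R < ‖f^[n] z‖) :
    Tendsto (iterateOn f U) atTop (𝓝 (ContinuousMap.const U OnePoint.infty)) := by
  rw [ContinuousMap.tendsto_nhds_compactOpen]
  intro C _ V hV hCV
  rcases C.eq_empty_or_nonempty with rfl | ⟨c, hc⟩
  · exact Eventually.of_forall fun n => mapsTo_empty _ _
  · have h1 : ((↑) : ℂ → OnePoint ℂ) ⁻¹' V ∈ Filter.coclosedCompact ℂ := by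
      rw [← OnePoint.comap_coe_nhds_infty]
      exact preimage_mem_comap (hV.mem_nhds (hCV hc))
    rw [Filter.coclosedCompact_eq_cocompact, ← Metric.cobounded_eq_cocompact] at h1
    obtain ⟨R, -, hR⟩ := (Filter.hasBasis_cobounded_norm (E := ℂ)).mem_iff.mp h1
    filter_upwards [h R] with n hn z _
    exact hR (hn z z.2).le

/-- A sequence of indices either takes some value infinitely often or tends to infinity. -/
theorem isNormalFamily_range_of_tendsto {U : Set ℂ} {F : ℕ → C(U, OnePoint ℂ)}
    {g : C(U, OnePoint ℂ)} (h : Tendsto F atTop (𝓝 g)) : IsNormalFamily (range F) := by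
  intro u hu
  choose n hn using hu
  by_cases hb : ∃ N, ∃ᶠ k in atTop, n k = N
  · obtain ⟨N, hN⟩ := hb
    obtain ⟨φ, hφ, hφN⟩ := extraction_of_frequently_atTop hN
    refine ⟨φ, hφ, F N, tendsto_const_nhds.congr fun k => ?_⟩
    rw [Function.comp_apply, ← hn, hφN]
  · have hn' : Tendsto n atTop atTop := by
      refine tendsto_atTop.mpr fun N => ?_
      simp only [not_exists, not_frequently] at hb
      filter_upwards [(finite_lt_nat N).eventually_all.mpr fun i _ => hb i] with k hk
      exact le_of_not_gt fun hlt => hk (n k) hlt rfl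
    refine ⟨id, strictMono_id, g, (h.comp hn').congr fun k => hn k⟩

theorem notMem_fatouSet {f : C(ℂ, ℂ)} {Ω : Set ℂ} {p : ℕ → ℂ} {x : ℂ} (hx : x ∈ closure Ω)
    (h : ∀ z ∈ Ω, ∀ R : ℝ, ∀ᶠ n in atTop, R < ‖f^[n] z‖)
    (hp : ∀ k, ‖f^[k + 1] (p k)‖ ≤ 1) (hpx : ∀ r > 0, ∀ n, ∃ k ≥ n, dist (p k) x < r) :
    x ∉ fatouSet f := by
  rintro ⟨U, hU, hxU, hnorm⟩
  obtain ⟨r, hr, hrU⟩ := Metric.isOpen_iff.mp hU x hxU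
  choose k hkn hkx using fun n : ℕ =>
    hpx (min r (1 / (n + 1))) (lt_min hr Nat.one_div_pos_of_nat) n
  have hkU : ∀ n, p (k n) ∈ U := fun n => hrU ((hkx n).trans_le (min_le_left _ _))
  have hkx' : Tendsto (fun n => p (k n)) atTop (𝓝 x) := by
    rw [tendsto_iff_dist_tendsto_zero]
    exact squeeze_zero (fun _ => dist_nonneg) (fun n => ((hkx n).trans_le (min_le_right _ _)).le)
      tendsto_one_div_add_atTop_nhds_zero_nat
  obtain ⟨φ, hφ, g, hg⟩ := hnorm (fun n => iterateOn f U (k n + 1)) fun n => mem_range_self _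
  have hk : Tendsto (fun n => k (φ n) + 1) atTop atTop :=
    tendsto_atTop_mono (fun n => (hφ.id_le n).trans ((hkn (φ n)).trans (Nat.le_succ _))) tendsto_id
  have hgΩ : ∀ z : U, (z : ℂ) ∈ Ω → g z = OnePoint.infty := by
    intro z hz
    have h1 : Tendsto (fun n => (iterateOn f U (k (φ n) + 1)) z) atTop (𝓝 (g z)) :=
      ((continuous_eval_const z).tendsto g).comp hg
    refine tendsto_nhds_unique h1 ?_
    have h2 : Tendsto (fun n => f^[n] (z : ℂ)) atTop (Bornology.cobounded ℂ) := by
      rw [← tendsto_norm_atTop_iff_cobounded, Filter.tendsto_atTop]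
      exact fun R => (h z hz R).mono fun n hn => hn.le
    rw [Metric.cobounded_eq_cocompact, ← Filter.coclosedCompact_eq_cocompact] at h2
    exact OnePoint.tendsto_coe_infty.comp (h2.comp hk)
  have hgx : g ⟨x, hxU⟩ = OnePoint.infty := by
    have hcl : (⟨x, hxU⟩ : U) ∈ closure ((↑) ⁻¹' Ω : Set U) := by
      rw [← hU.isOpenMap_subtype_val.preimage_closure_eq_closure_preimage continuous_subtype_val]
      exact hx
    have hcl' : IsClosed {z : U | g z = OnePoint.infty} :=
      isClosed_eq g.continuous continuous_const
    exact hcl'.closure_subset_iff.mpr hgΩ hcl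
  have : LocallyCompactSpace U := hU.locallyCompactSpace
  have hpU : Tendsto (fun n => (⟨p (k (φ n)), hkU _⟩ : U)) atTop (𝓝 ⟨x, hxU⟩) :=
    tendsto_subtype_rng.mpr (hkx'.comp hφ.tendsto_atTop)
  -- Evaluation is jointly continuous on the locally compact U, so g x is a limit of values in the
  -- closed unit disc.
  have heval : Tendsto (fun n => (iterateOn f U (k (φ n) + 1)) ⟨p (k (φ n)), hkU _⟩) atTop
      (𝓝 (g ⟨x, hxU⟩)) :=
    (ContinuousEval.continuous_eval.tendsto (g, (⟨x, hxU⟩ : U))).comp (hg.prodMk_nhds hpU)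
  have hclosed : IsClosed (((↑) : ℂ → OnePoint ℂ) '' closedBall 0 1) :=
    ((isCompact_closedBall 0 1).image OnePoint.continuous_coe).isClosed
  have hmem := hclosed.mem_of_tendsto heval (Eventually.of_forall fun n =>
    ⟨_, mem_closedBall_zero_iff.mpr (hp (k (φ n))), rfl⟩)
  rw [hgx] at hmem
  obtain ⟨w, -, hw⟩ := hmem
  exact OnePoint.coe_ne_infty w hw

/-- A connected subset of the Fatou set that meets Ω cannot leave it without crossing its frontier.
-/
theorem isFatouComponent_of_frontier {f : C(ℂ, ℂ)} {Ω : Set ℂ} (hΩ : IsOpen Ω)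
    (hΩc : IsConnected Ω) (hsub : Ω ⊆ fatouSet f) (hfr : ∀ x ∈ frontier Ω, x ∉ fatouSet f) :
    IsFatouComponent f Ω := by
  obtain ⟨p, hp⟩ := hΩc.nonempty
  refine ⟨p, hsub hp, (hΩc.isPreconnected.subset_connectedComponentIn hp hsub).antisymm ?_⟩
  refine isPreconnected_connectedComponentIn.subset_of_closure_inter_subset hΩ
    ⟨p, mem_connectedComponentIn (hsub hp), hp⟩ fun z hz => ?_
  by_contra hzΩ
  exact hfr z (by rw [hΩ.frontier_eq]; exact ⟨hz.1, hzΩ⟩) (connectedComponentIn_subset _ _ hz.2)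

end EntireDynamics

/-! ### The main theorem -/

theorem theorem1 (Ω : Set ℂ) (hΩ_open : IsOpen Ω) (hΩ_bounded : Bornology.IsBounded Ω)
    (hΩ_connected : IsConnected Ω) (hΩ_regular : interior (closure Ω) = Ω)
    (hΩ_compl : IsConnected (closure Ω)ᶜ) :
    ∃ f : C(ℂ, ℂ), Differentiable ℂ f ∧
      EntireDynamics.IsEscapingWanderingDomain f Ω ∧
      ∀ n : ℕ, EntireDynamics.IsUnivalentOn f^[n] Ω := by
  have hK : IsCompact (closure Ω) := hΩ_bounded.isCompact_closure
  -- Regularity enters here: every boundary point of Ω is a limit of points outside the closure,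
  -- where the p k are chosen.
  have hfrontier : frontier (closure Ω) = frontier Ω := by
    rw [frontier, closure_closure, hΩ_regular, hΩ_open.frontier_eq]
  have hne : (frontier (closure Ω)).Nonempty := by
    rw [nonempty_frontier_iff]
    exact ⟨hΩ_connected.nonempty.closure, fun h => by simpa [h] using hΩ_compl.nonempty⟩
  obtain ⟨D, hD⟩ := EntireDynamics.exists_shrinkingData hK hΩ_compl.isPreconnected hne
  obtain ⟨f, hf, htrack⟩ := D.exists_entire_isTracking hK
  choose h hh htrack using htrack
  have hsub : ∀ k, Ω ⊆ D.nhd k := fun k =>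
    subset_closure.trans (Metric.self_subset_cthickening _)
  have horb : ∀ k, ∀ z ∈ Ω, f^[k] z ∈ Metric.closedBall (D.center k) D.ρ := fun k z hz =>
    (htrack k).1 k le_rfl z (hsub k hz)
  have hesc : ∀ R : ℝ, ∀ᶠ n in atTop, ∀ z ∈ Ω, R < ‖f^[n] z‖ := by
    intro R
    have h1 : Tendsto (fun k : ℕ => 5 * D.ρ * 7 ^ k - 6 * D.ρ) atTop atTop :=
      tendsto_atTop_add_const_right _ _ ((tendsto_pow_atTop_atTop_of_one_lt (by norm_num)
        ).const_mul_atTop (by linarith [D.ρ_pos]))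
    filter_upwards [h1.eventually_gt_atTop R] with n hn z hz
    exact hn.trans_le (D.norm_of_mem_closedBall_center (horb n z hz))
  have hlim := EntireDynamics.tendsto_iterateOn_infty (f := ⟨f, hf.continuous⟩) hesc
  refine ⟨⟨f, hf.continuous⟩, hf, ⟨⟨?_, ?_⟩, ?_⟩, fun n => ⟨(hf.iterate n).differentiableOn, ?_⟩⟩
  · refine EntireDynamics.isFatouComponent_of_frontier hΩ_open hΩ_connected (fun z hz =>
      ⟨Ω, hΩ_open, hz, EntireDynamics.isNormalFamily_range_of_tendsto hlim⟩) fun x hx => ?_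
    refine EntireDynamics.notMem_fatouSet (p := D.p) (frontier_subset_closure hx)
      (fun z hz R => (hesc R).mono fun n hn => hn z hz)
      (fun k => (htrack (k + 1)).2.2 k k.lt_succ_self) (hD x (hfrontier ▸ hx))
  · rintro ⟨n, m, hnm, w, ⟨z, hz, rfl⟩, ⟨z', hz', hzz'⟩⟩
    have h1 := horb n z hz
    have h2 := horb m z' hz'
    change f^[m] z' = f^[n] z at hzz'
    rw [hzz'] at h2
    rcases lt_or_gt_of_ne hnm with hlt | hlt
    · exact (D.disjoint_closedBall_center hlt).le_bot ⟨h1, h2⟩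
    · exact (D.disjoint_closedBall_center hlt).le_bot ⟨h2, h1⟩
  · refine eq_singleton_iff_unique_mem.mpr ⟨⟨id, strictMono_id, hlim⟩, ?_⟩
    rintro g ⟨φ, hφ, hg⟩
    exact tendsto_nhds_unique hg (hlim.comp hφ.tendsto_atTop)
  · exact (EntireDynamics.injOn_of_approximate_left_inverse (D.δ_pos n) (hf.iterate n) (hh n)
      (htrack n).2.1).mono subset_closure
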